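/- **Setting.** Let $\mathcal{X}\subseteq\mathbb{R}^d$ be a sample space with a $\sigma$-finite reference measure $\lambda$ (for example Lebesgue measure, or counting measure if $\mathcal{X}$ is countable), and let $X^\infty=(X_1,X_2,\ldots)$ take values in $\mathcal{X}$. A *prediction strategy* $p$ assigns to every $n\ge 0$ and every history $x^n=(x_1,\ldots,x_n)\in\mathcal{X}^n$ a probability density $p(\cdot\mid x^n)$ with respect to $\lambda$ for the next outcome $X_{n+1}$, measurably in the history and the outcome. Write $p(x^n)=\prod_{i=1}^n p(x_i\mid x^{i-1})$, let $P$ be the distribution of $X^\infty$ that $p$ defines, and for every $x^n\in\mathcal{X}^n$ let $P(X_{n+1}^\infty\mid x^n)$ be the distribution of $X_{n+1},X_{n+2},\ldots$ defined by the predictions of $p$ after the history $x^n$. For every $k\in\mathbb{Z}^+=\{1,2,\ldots\}$ let $\mathcal{M}_k=\{p_\theta:\theta\in\Theta_k\}$, $\Theta_k\subseteq\mathbb{R}^{d_k}$, be a parametric model, that is, a family of prediction strategies whose densities are jointly measurable in $\theta$, the history and the outcome, and let $w_k$ be a prior probability distribution on $\Theta_k$. Let $\bar p_k$ be a Bayesian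 prediction strategy for $\mathcal{M}_k$ and $w_k$: with $m_k(x^n)=\int_{\Theta_k}p_\theta(x^n)\,dw_k(\theta)$, it satisfies $\bar p_k(x_{n+1}\mid x^n)=m_k(x^{n+1})/m_k(x^n)$ whenever $0<m_k(x^n)<\infty$ (on other histories it may be any prediction). Write $\bar P_k$ for the distribution defined by $\bar p_k$. Let $\mathbb{S}$ be the set of all finite sequences $\mathbf{s}=((t_1,k_1),\ldots,(t_m,k_m))$ with $m\ge1$, $k_i\in\mathbb{Z}^+$, and integers $0=t_1<\cdots<t_m$; write $m(\mathbf{s})=m$. Let $K_{n+1}(\mathbf{s})=k_i$ for the largest $i$ with $t_i\le n$, let $q_{\mathbf{s}}$ be the prediction strategy $q_{\mathbf{s}}(\cdot\mid x^n)=\bar p_{K_{n+1}(\mathbf{s})}(\cdot\mid x^n)$, and let $E_{\mathbf{s}}\subseteq\mathbb{S}$ be the set of all $\mathbf{s}'$ with $m(\mathbf{s}')>m(\mathbf{s})$ whose first $m(\mathbf{s})$ pairs are those of $\mathbf{s}$. For a probability mass function $\pi$ on $\mathbb{S}$, the posterior of the switch distribution on the model used at time $n+1$ is $$\pi(K_{n+1}=k\mid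 x^n)=\frac{\sum_{\mathbf{s}:K_{n+1}(\mathbf{s})=k}q_{\mathbf{s}}(x^n)\,\pi(\mathbf{s})}{\sum_{\mathbf{s}\in\mathbb{S}}q_{\mathbf{s}}(x^n)\,\pi(\mathbf{s})}.$$ **Theorem (consistency of the switch distribution).** Suppose that $\pi(\mathbf{s})>0$ for every $\mathbf{s}\in\mathbb{S}$ with $m(\mathbf{s})=1$, and that for some constant $c>0$ we have $c\cdot\pi(\mathbf{s})\ge\pi(E_{\mathbf{s}})$ for every $\mathbf{s}\in\mathbb{S}$. Suppose further that $\bar P_k(X_{n+1}^\infty\mid x^n)$ and $\bar P_{k'}(X_{n+1}^\infty\mid x^n)$ are mutually singular for all $k\ne k'$ in $\mathbb{Z}^+$, all $n\ge0$ and all $x^n\in\mathcal{X}^n$. Then for all $k^*\in\mathbb{Z}^+$ and for all $\theta^*\in\Theta_{k^*}$ outside a set of $w_{k^*}$-measure $0$, $$\pi(K_{n+1}=k^*\mid X^n)\longrightarrow 1\quad(n\to\infty)\qquad\text{with }P_{\theta^*}\text{-probability }1.$$ -/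

import Mathlib

open MeasureTheory ProbabilityTheory Filter Topology
open scoped ENNReal NNReal

/-- A prediction strategy for sequences of outcomes in `X`, with densities relative to the reference
measure `μ`: for each history `h = (x₁, …, xₙ)` it issues a probability density `dens n h` for the
next outcome `xₙ₊₁`, depending measurably on the history and the outcome. -/
structure PredictionStrategy {X : Type*} [MeasurableSpace X] (μ : Measure X) where
  dens : (n : ℕ) → (Fin n → X) → X → ℝ≥0∞
  measurable_dens : ∀ n, Measurable fun z : (Fin n → X) × X => dens n z.1 z.2
  lintegral_dens : ∀ n h, ∫⁻ x, dens n h x ∂μ = 1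

namespace PredictionStrategy

variable {X : Type*} [MeasurableSpace X] {μ : Measure X}

/-- The joint density `p(x₁) p(x₂ | x₁) ⋯ p(xₙ | x₁, …, xₙ₋₁)`. -/
noncomputable def joint (p : PredictionStrategy μ) (n : ℕ) (x : Fin n → X) : ℝ≥0∞ :=
  ∏ i : Fin n, p.dens i (fun j : Fin i => x (Fin.castLE i.isLt.le j)) (x i)

theorem measurable_append {n m : ℕ} (h : Fin n → X) :
    Measurable fun y : Fin m → X => Fin.append h y := by
  refine measurable_pi_lambda _ fun i => ?_
  refine Fin.addCases (fun i => ?_) (fun i => ?_) i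
  · simp
  · simpa using measurable_pi_apply i

/-- The strategy for `Xₙ₊₁, Xₙ₊₂, …` that `p` induces once the history `h = (x₁, …, xₙ)` has been
observed. -/
def cond (p : PredictionStrategy μ) {n : ℕ} (h : Fin n → X) : PredictionStrategy μ where
  dens m y x := p.dens (n + m) (Fin.append h y) x
  measurable_dens m := (p.measurable_dens (n + m)).comp
    (((measurable_append h).comp measurable_fst).prodMk measurable_snd)
  lintegral_dens m y := p.lintegral_dens (n + m) (Fin.append h y)

/-- The Markov kernel that sends the history `x 0, …, x n` to the distribution of `x (n + 1)`. -/
noncomputable def step [SigmaFinite μ] (p : PredictionStrategy μ) (n : ℕ) :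
    Kernel (Finset.Iic n → X) X :=
  (Kernel.const _ μ).withDensity fun h x =>
    p.dens (n + 1) (fun i : Fin (n + 1) => h ⟨i, Finset.mem_Iic.2 (Nat.lt_succ_iff.1 i.isLt)⟩) x

theorem measurable_step_dens (p : PredictionStrategy μ) (n : ℕ) :
    Measurable (Function.uncurry fun (h : Finset.Iic n → X) x => p.dens (n + 1)
      (fun i : Fin (n + 1) => h ⟨i, Finset.mem_Iic.2 (Nat.lt_succ_iff.1 i.isLt)⟩) x) := by
  have hm : Measurable fun z : (Finset.Iic n → X) × X =>
      ((fun i : Fin (n + 1) => z.1 ⟨i, Finset.mem_Iic.2 (Nat.lt_succ_iff.1 i.isLt)⟩), z.2) :=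
    (measurable_pi_lambda _ fun i => (measurable_pi_apply _).comp measurable_fst).prodMk
      measurable_snd
  exact (p.measurable_dens (n + 1)).comp hm

instance [SigmaFinite μ] (p : PredictionStrategy μ) (n : ℕ) : IsMarkovKernel (p.step n) := by
  refine ⟨fun h => ⟨?_⟩⟩
  rw [step, Kernel.withDensity_apply' _ (p.measurable_step_dens n)]
  simpa using p.lintegral_dens (n + 1) _

/-- The distribution `P(X^∞)` on infinite sequences that the strategy `p` defines; `x i` is the
outcome `Xᵢ₊₁`. -/
noncomputable def law [SigmaFinite μ] (p : PredictionStrategy μ) : Measure (ℕ → X) :=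
  Kernel.trajMeasure (X := fun _ => X) (μ.withDensity (p.dens 0 Fin.elim0)) p.step

end PredictionStrategy

/-- A parametric model: prediction strategies `p_θ`, indexed by `θ ∈ Θ ⊆ ℝ^dim`, whose densities are
jointly measurable in the parameter, the history and the outcome. -/
structure ParametricModel {X : Type*} [MeasurableSpace X] (μ : Measure X) where
  dim : ℕ
  Θ : Set (EuclideanSpace ℝ (Fin dim))
  strat : Θ → PredictionStrategy μ
  measurable_strat : ∀ n, Measurable fun z : Θ × (Fin n → X) × X =>
    (strat z.1).dens n z.2.1 z.2.2

namespace ParametricModel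

variable {X : Type*} [MeasurableSpace X] {μ : Measure X}

/-- The Bayesian marginal density `∫ p_θ(x₁, …, xₙ) dw(θ)`. -/
noncomputable def marginal (M : ParametricModel μ) (w : Measure M.Θ) (n : ℕ) (x : Fin n → X) :
    ℝ≥0∞ :=
  ∫⁻ θ, (M.strat θ).joint n x ∂w

/-- `p` is a Bayesian prediction strategy for the model `M` and the prior `w`: wherever the Bayesian
marginal density of the history is positive (and finite), `p` predicts with the conditional density
that the marginal induces. On other histories that conditional density is undefined, and `p` may
predict in any way. -/
def IsBayes (M : ParametricModel μ) (w : Measure M.Θ) (p : PredictionStrategy μ) : Prop :=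
  ∀ (n : ℕ) (h : Fin n → X), M.marginal w n h ≠ 0 → M.marginal w n h ≠ ∞ →
    ∀ x, p.dens n h x = M.marginal w (n + 1) (Fin.snoc h x) / M.marginal w n h

end ParametricModel

/-- A switching parameter `s = ((t₁, k₁), …, (t_m, k_m))`, with `m ≥ 1` and
`0 = t₁ < ⋯ < t_m`. -/
structure SwitchParam where
  segs : List (ℕ × ℕ+)
  ne_nil : segs ≠ []
  start : (segs.head ne_nil).1 = 0
  increasing : segs.Pairwise fun a b => a.1 < b.1

namespace SwitchParam

/-- The number `m` of segments. -/
def m (s : SwitchParam) : ℕ := s.segs.length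

theorem filter_ne_nil (s : SwitchParam) (n : ℕ) :
    s.segs.filter (fun a => decide (a.1 ≤ n)) ≠ [] := by
  apply List.ne_nil_of_mem (a := s.segs.head s.ne_nil)
  simp [s.start]

/-- `s.K n` is `Kₙ₊₁(s)`, the index of the strategy that `s` uses to predict `Xₙ₊₁` after `n`
outcomes: that of the last segment whose switch-point is at most `n`. -/
def K (s : SwitchParam) (n : ℕ) : ℕ+ :=
  ((s.segs.filter fun a => decide (a.1 ≤ n)).getLast (s.filter_ne_nil n)).2

/-- The set `E_s` of proper extensions of `s` to more switch-points. -/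
def ext (s : SwitchParam) : Set SwitchParam :=
  {s' | s.m < s'.m ∧ s.segs <+: s'.segs}

end SwitchParam

section Switch

variable {X : Type*} [MeasurableSpace X] {μ : Measure X}

/-- The combinator strategy `q_s`, which switches between the strategies `p₁, p₂, …`. -/
def switchStrategy (p : ℕ+ → PredictionStrategy μ) (s : SwitchParam) : PredictionStrategy μ where
  dens n := (p (s.K n)).dens n
  measurable_dens n := (p (s.K n)).measurable_dens n
  lintegral_dens n := (p (s.K n)).lintegral_dens n

/-- The marginal density `p_sw(x₁, …, xₙ) = ∑_s q_s(x₁, …, xₙ) π(s)` of the switch distribution with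
prior `π`. -/
noncomputable def switchMarginal (π : PMF SwitchParam) (p : ℕ+ → PredictionStrategy μ) (n : ℕ)
    (x : Fin n → X) : ℝ≥0∞ :=
  ∑' s : SwitchParam, (switchStrategy p s).joint n x * π s

/-- The posterior probability `π(Kₙ₊₁ = k | x₁, …, xₙ)`. -/
noncomputable def switchPosterior (π : PMF SwitchParam) (p : ℕ+ → PredictionStrategy μ) (n : ℕ)
    (x : Fin n → X) (k : ℕ+) : ℝ≥0∞ :=
  (∑' s : {s : SwitchParam // s.K n = k}, (switchStrategy p s.1).joint n x * π s.1) /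
    switchMarginal π p n x

end Switch

/-!
The prior mixture of the laws `P_θ`, `θ ∈ Θ_k`, is the law of the Bayesian strategy `p k`
(`IsBayes.law_eq_bind`), so it suffices to prove convergence almost surely under the law of
`p kstar`.

The posterior odds against `kstar` at time `n` are the ratio of two sums over switching parameters.
The sum for `kstar` is at least the term of the parameter that never leaves `kstar`. In the other
sum, every `s` may be replaced by its truncation at time `n`, which predicts the first `n` outcomes
in the same way; the condition on `π` bounds the total prior weight of the parameters with a given
truncation, so the sum is at most `(1 + c) ∑ q_s(x₁, …, xₙ) π(s)`, over those `s` whose last model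
is not `kstar` (`tsum_K_ne_le`). These `s` no longer depend on `n`.

Such an `s` predicts like `p k`, with `k ≠ kstar` its last model, from some time on. Disintegrating
the laws over the history up to that time shows that the law of `q_s` and the law of `p kstar` are
mutually singular (`mutuallySingular_law_of_cond`), hence so are the countable mixture of the
former and the latter. If `P` and `Q` are mutually singular, then by Lévy's upward theorem the density ratio
of `Q` to `P` on the first `n` outcomes tends to `0` almost surely under `P`
(`tendsto_density_div_add`), so the posterior odds against `kstar` vanish.
-/

/-! ### Initial segments of a sequence -/

/-- The first `n` terms of an infinite sequence. -/
def initialSeg {X : Type*} (n : ℕ) (x : ℕ → X) : Fin n → X := fun i => x i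

theorem initialSeg_eq_comp {X : Type*} {n m : ℕ} (hnm : n ≤ m) :
    (initialSeg n : (ℕ → X) → Fin n → X) =
      (fun y : Fin m → X => fun i : Fin n => y (Fin.castLE hnm i)) ∘ initialSeg m := rfl

section InitialSeg

variable {X : Type*} [MeasurableSpace X]

theorem measurable_initialSeg (n : ℕ) : Measurable (initialSeg n : (ℕ → X) → Fin n → X) :=
  measurable_pi_lambda _ fun _ => measurable_pi_apply _

theorem measurable_castLE {n m : ℕ} (hnm : n ≤ m) :
    Measurable fun y : Fin m → X => fun i : Fin n => y (Fin.castLE hnm i) :=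
  measurable_pi_lambda _ fun _ => measurable_pi_apply _

/-- The filtration generated by the initial segments. -/
def initialFiltration : Filtration ℕ (inferInstance : MeasurableSpace (ℕ → X)) where
  seq n := MeasurableSpace.comap (initialSeg n) inferInstance
  mono' n m hnm := by
    beta_reduce
    rw [initialSeg_eq_comp hnm, ← MeasurableSpace.comap_comp]
    exact MeasurableSpace.comap_mono (measurable_castLE hnm).comap_le
  le' n := (measurable_initialSeg n).comap_le

theorem iSup_initialFiltration :
    ⨆ n, (initialFiltration (X := X)) n = (inferInstance : MeasurableSpace (ℕ → X)) := by
  refine le_antisymm (iSup_le fun n => initialFiltration.le n) (iSup_le fun i => ?_)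
  refine le_trans ?_ (le_iSup _ (i + 1))
  have : (fun x : ℕ → X => x i) = (fun y : Fin (i + 1) → X => y (Fin.last i)) ∘
    initialSeg (i + 1) := rfl
  change MeasurableSpace.comap (fun x : ℕ → X => x i) _ ≤ _
  rw [this, ← MeasurableSpace.comap_comp]
  exact MeasurableSpace.comap_mono (measurable_pi_apply (Fin.last i)).comap_le

theorem isPiSystem_initialFiltration :
    IsPiSystem {s : Set (ℕ → X) | ∃ n, MeasurableSet[initialFiltration n] s} := by
  rintro s ⟨n, hs⟩ t ⟨m, ht⟩ -
  exact ⟨max n m, (initialFiltration.mono (le_max_left n m) s hs).inter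
    (initialFiltration.mono (le_max_right n m) t ht)⟩

theorem generateFrom_initialFiltration :
    (inferInstance : MeasurableSpace (ℕ → X)) =
      MeasurableSpace.generateFrom {s | ∃ n, MeasurableSet[initialFiltration n] s} := by
  conv_lhs => rw [← iSup_initialFiltration, ← MeasurableSpace.generateFrom_iUnion_measurableSet]
  congr 1
  ext s
  simp

/-- A finite measure on sequences is determined by the distributions of its initial segments,
and those of length at least `t` are enough. -/
theorem Measure.ext_of_map_initialSeg {P Q : Measure (ℕ → X)} [IsFiniteMeasure P] (t : ℕ)
    (h : ∀ m, P.map (initialSeg (t + m)) = Q.map (initialSeg (t + m))) : P = Q := by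
  have key (s : Set (ℕ → X)) (n : ℕ) (hs : MeasurableSet[initialFiltration n] s) : P s = Q s := by
    obtain ⟨A, hA, rfl⟩ := initialFiltration.mono (Nat.le_add_left n t) s hs
    rw [← Measure.map_apply (measurable_initialSeg _) hA, h,
      Measure.map_apply (measurable_initialSeg _) hA]
  refine ext_of_generate_finite _ generateFrom_initialFiltration isPiSystem_initialFiltration ?_
    (key _ 0 MeasurableSet.univ)
  rintro s ⟨n, hs⟩
  exact key s n hs

end InitialSeg

theorem countablyGenerated_sequence {X : Type*} [MeasurableSpace X]
    [MeasurableSpace.CountablyGenerated X] : MeasurableSpace.CountablyGenerated (ℕ → X) := by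
  refine ⟨⋃ i : ℕ, Set.preimage (fun x : ℕ → X => x i) ''
    MeasurableSpace.countableGeneratingSet X, Set.countable_iUnion fun i =>
      MeasurableSpace.countable_countableGeneratingSet.image _, ?_⟩
  rw [← MeasurableSpace.iSup_generateFrom]
  simp only [← MeasurableSpace.comap_generateFrom,
    MeasurableSpace.generateFrom_countableGeneratingSet]
  rfl

/-! ### Integrals over products -/

section Pi

variable {X : Type*} [MeasurableSpace X] (μ : Measure X) [SigmaFinite μ]

theorem measurable_snoc {n : ℕ} :
    Measurable fun z : (Fin n → X) × X => (Fin.snoc z.1 z.2 : Fin (n + 1) → X) := by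
  refine measurable_pi_lambda _ fun i => ?_
  refine Fin.lastCases ?_ (fun i => ?_) i
  · simpa using measurable_snd
  · simpa using measurable_fst.eval

theorem lintegral_pi_succ {n : ℕ} {f : (Fin (n + 1) → X) → ℝ≥0∞} (hf : Measurable f) :
    ∫⁻ y, f y ∂Measure.pi (fun _ => μ) =
      ∫⁻ h, ∫⁻ x, f (Fin.snoc h x) ∂μ ∂Measure.pi fun _ : Fin n => μ := by
  have e := (measurePreserving_piFinSuccAbove (fun _ : Fin (n + 1) => μ) (Fin.last n)).symm
  rw [← e.lintegral_comp hf, lintegral_prod_symm']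
  · simp [MeasurableEquiv.piFinSuccAbove, Fin.insertNthEquiv, Fin.insertNth_last']
  · exact hf.comp (MeasurableEquiv.measurable _)

theorem measurable_append_uncurry {n m : ℕ} :
    Measurable fun z : (Fin n → X) × (Fin m → X) => Fin.append z.1 z.2 := by
  refine measurable_pi_lambda _ fun i => ?_
  refine Fin.addCases (fun i => ?_) (fun i => ?_) i
  · simpa using measurable_fst.eval
  · simpa using measurable_snd.eval

theorem lintegral_pi_add {n m : ℕ} {f : (Fin (n + m) → X) → ℝ≥0∞} (hf : Measurable f) :
    ∫⁻ y, f y ∂Measure.pi (fun _ => μ) =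
      ∫⁻ h, ∫⁻ y, f (Fin.append h y) ∂Measure.pi (fun _ : Fin m => μ)
        ∂Measure.pi fun _ : Fin n => μ := by
  induction m with
  | zero =>
    refine lintegral_congr fun h => ?_
    rw [Measure.pi_of_empty, lintegral_dirac' (f := fun y => f (Fin.append h y)) _
      (hf.comp (PredictionStrategy.measurable_append h))]
    congr 1
    ext i
    exact (Fin.append_left h _ i).symm
  | succ m ih =>
    have h1 := measurable_snoc (X := X) (n := n + m)
    change ∫⁻ y : Fin (n + m + 1) → X, f y ∂Measure.pi (fun _ => μ) = _
    rw [lintegral_pi_succ (n := n + m) μ hf,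
      ih (f := fun h => ∫⁻ x, f (Fin.snoc h x) ∂μ) (hf.comp h1).lintegral_prod_right']
    refine lintegral_congr fun h => ?_
    rw [lintegral_pi_succ (f := fun y => f (Fin.append h y)) μ
      (hf.comp (PredictionStrategy.measurable_append h))]
    refine lintegral_congr fun y => lintegral_congr fun x => ?_
    rw [Fin.append_snoc]

end Pi

/-! ### Joint densities and distributions of initial segments -/

namespace PredictionStrategy

variable {X : Type*} [MeasurableSpace X] {μ : Measure X}

section Joint

variable (p : PredictionStrategy μ)

theorem joint_zero (x : Fin 0 → X) : p.joint 0 x = 1 := by simp [joint]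

theorem joint_snoc {n : ℕ} (h : Fin n → X) (x : X) :
    p.joint (n + 1) (Fin.snoc h x) = p.joint n h * p.dens n h x := by
  have key (i : Fin n) (j : Fin i) :
      (Fin.snoc h x : Fin (n + 1) → X) (Fin.castLE i.castSucc.isLt.le j) =
        h (Fin.castLE i.isLt.le j) :=
    Fin.snoc_castSucc (α := fun _ => X) x h (Fin.castLE i.isLt.le j)
  have key' (j : Fin n) : (Fin.snoc h x : Fin (n + 1) → X) (Fin.castLE (Fin.last n).isLt.le j) =
      h j := Fin.snoc_castSucc (α := fun _ => X) x h j
  rw [joint, Fin.prod_univ_castSucc, joint]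
  congr 1
  · refine Finset.prod_congr rfl fun i _ => ?_
    rw [Fin.snoc_castSucc]
    change p.dens i _ _ = p.dens i _ _
    congr 1
    exact funext (key i)
  · rw [Fin.snoc_last]
    change p.dens n _ _ = p.dens n _ _
    congr 1
    exact funext key'

theorem joint_append {n m : ℕ} (h : Fin n → X) (y : Fin m → X) :
    p.joint (n + m) (Fin.append h y) = p.joint n h * (p.cond h).joint m y := by
  induction m with
  | zero =>
    rw [joint_zero, mul_one]
    change p.joint n _ = p.joint n _
    congr 1
    ext i
    exact Fin.append_left h y i
  | succ m ih =>
    induction y using Fin.snocCases with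
    | snoc y x =>
      rw [Fin.append_snoc, joint_snoc, ← mul_assoc, ← ih]
      exact p.joint_snoc (n := n + m) _ x

end Joint

section Family

variable {T : Type*} [MeasurableSpace T] {s : T → PredictionStrategy μ}

theorem measurable_joint_family
    (hs : ∀ n, Measurable fun z : T × (Fin n → X) × X => (s z.1).dens n z.2.1 z.2.2) (n : ℕ) :
    Measurable fun z : T × (Fin n → X) => (s z.1).joint n z.2 := by
  refine Finset.measurable_prod _ fun i _ => ?_
  have : Measurable fun z : T × (Fin n → X) =>
      (z.1, (fun j : Fin i => z.2 (Fin.castLE i.isLt.le j)), z.2 i) :=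
    measurable_fst.prodMk (((measurable_castLE i.isLt.le).comp measurable_snd).prodMk
      measurable_snd.eval)
  exact (hs i).comp this

end Family

theorem measurable_joint (p : PredictionStrategy μ) (n : ℕ) : Measurable (p.joint n) :=
  (measurable_joint_family (T := Unit) (s := fun _ => p)
    (fun n => (p.measurable_dens n).comp measurable_snd) n).comp
    (measurable_const (a := ()) |>.prodMk measurable_id)

variable [SigmaFinite μ] (p : PredictionStrategy μ)

instance : IsProbabilityMeasure p.law := by
  have : IsProbabilityMeasure (μ.withDensity (p.dens 0 Fin.elim0)) :=
    ⟨by simpa using p.lintegral_dens 0 Fin.elim0⟩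
  unfold law
  infer_instance

theorem map_eval_zero_law :
    p.law.map (fun x => x 0) = μ.withDensity (p.dens 0 Fin.elim0) := by
  have : (fun x : ℕ → X => x 0) =
      (fun y : Finset.Iic 0 → X => y ⟨0, by simp⟩) ∘ Preorder.frestrictLe (π := fun _ => X) 0 := rfl
  rw [this, ← Measure.map_map (by fun_prop) (by fun_prop), law, Kernel.trajMeasure,
    Measure.map_comp _ _ (by fun_prop), Kernel.traj_map_frestrictLe, Kernel.partialTraj_self,
    Measure.id_comp, Measure.map_map (by fun_prop) (by fun_prop)]
  exact Measure.map_id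

theorem lintegral_law_succ (n : ℕ) {f : (Fin (n + 1) → X) → ℝ≥0∞} (hf : Measurable f) :
    ∫⁻ x, f (initialSeg (n + 1) x) ∂p.law =
      ∫⁻ x, ∫⁻ y, p.dens n (initialSeg n x) y * f (Fin.snoc (initialSeg n x) y) ∂μ ∂p.law := by
  cases n with
  | zero =>
    have h0 (x : ℕ → X) : initialSeg 0 x = Fin.elim0 := Subsingleton.elim _ _
    have hm : Measurable fun y : X => f (Fin.snoc (Fin.elim0 : Fin 0 → X) y) :=
      hf.comp (measurable_snoc.comp ((measurable_const (a := Fin.elim0)).prodMk measurable_id))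
    have hd : Measurable (p.dens 0 Fin.elim0) :=
      (p.measurable_dens 0).comp (measurable_const.prodMk measurable_id)
    have h1 (x : ℕ → X) : initialSeg 1 x = Fin.snoc (Fin.elim0 : Fin 0 → X) (x 0) := by
      ext i
      rw [Subsingleton.elim i (Fin.last 0), Fin.snoc_last]
      rfl
    simp only [h0, h1, lintegral_const, measure_univ, mul_one]
    rw [← lintegral_map hm (measurable_pi_apply 0), p.map_eval_zero_law,
      lintegral_withDensity_eq_lintegral_mul _ hd hm]
    rfl
  | succ n =>
    have h0 : IsProbabilityMeasure (μ.withDensity (p.dens 0 Fin.elim0)) :=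
      ⟨by simpa using p.lintegral_dens 0 Fin.elim0⟩
    -- `step` indexes histories by `Finset.Iic n`; `c` re-indexes them by `Fin (n + 1)`
    let c (h : Finset.Iic n → X) : Fin (n + 1) → X :=
      fun i => h ⟨i, Finset.mem_Iic.2 (Nat.lt_succ_iff.1 i.isLt)⟩
    have hc : Measurable c := measurable_pi_lambda _ fun _ => measurable_pi_apply _
    have hg : Measurable fun z : (Finset.Iic n → X) × X => f (Fin.snoc (c z.1) z.2) :=
      hf.comp (measurable_snoc.comp ((hc.comp measurable_fst).prodMk measurable_snd))
    have e : Measurable fun x : ℕ → X =>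
        (Preorder.frestrictLe (π := fun _ => X) n x, x (n + 1)) := by fun_prop
    have hcomp := Kernel.map_frestrictLe_trajMeasure_compProd_eq_map_trajMeasure
      (X := fun _ => X) (μ₀ := μ.withDensity (p.dens 0 Fin.elim0)) (κ := p.step) (a := n)
    have h1 (x : ℕ → X) : f (initialSeg (n + 1 + 1) x) =
        f (Fin.snoc (c (Preorder.frestrictLe (π := fun _ => X) n x)) (x (n + 1))) := by
      congr 1
      ext i
      refine Fin.lastCases ?_ (fun i => ?_) i
      · rw [Fin.snoc_last]; rfl
      · rw [Fin.snoc_castSucc]; rfl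
    simp only [h1]
    rw [← lintegral_map (f := fun z : (Finset.Iic n → X) × X => f (Fin.snoc (c z.1) z.2)) hg e]
    change ∫⁻ z, _ ∂(Kernel.trajMeasure _ _).map _ = _
    rw [← hcomp, Measure.lintegral_compProd hg, lintegral_map (hg.lintegral_kernel_prod_right')
      (by fun_prop)]
    refine lintegral_congr fun x => ?_
    rw [step, Kernel.lintegral_withDensity _ (p.measurable_step_dens n)]
    · rfl
    · exact hg.comp (measurable_const.prodMk measurable_id)

/-- The joint density of `p` is the density of the initial segment. -/
theorem lintegral_law_initialSeg (n : ℕ) {f : (Fin n → X) → ℝ≥0∞} (hf : Measurable f) :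
    ∫⁻ x, f (initialSeg n x) ∂p.law = ∫⁻ h, p.joint n h * f h ∂Measure.pi fun _ => μ := by
  induction n with
  | zero =>
    simp only [joint_zero, one_mul]
    rw [Measure.pi_of_empty, lintegral_dirac' _ hf]
    have (x : ℕ → X) : f (initialSeg 0 x) = f fun a => isEmptyElim a := by
      congr 1; exact Subsingleton.elim _ _
    simp [this]
  | succ n ih =>
    have hm : Measurable fun z : (Fin n → X) × X => p.dens n z.1 z.2 * f (Fin.snoc z.1 z.2) :=
      (p.measurable_dens n).mul (hf.comp measurable_snoc)
    rw [lintegral_law_succ p n hf, ih (f := fun h => ∫⁻ y, p.dens n h y * f (Fin.snoc h y) ∂μ)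
      hm.lintegral_prod_right', lintegral_pi_succ (f := fun h => p.joint (n + 1) h * f h) μ
        ((p.measurable_joint _).mul hf)]
    refine lintegral_congr fun h => ?_
    have hx : Measurable fun x => p.dens n h x * f (Fin.snoc h x) :=
      hm.comp (measurable_prodMk_left (x := h))
    rw [← lintegral_const_mul _ hx]
    refine lintegral_congr fun x => ?_
    rw [joint_snoc, mul_assoc]

theorem map_initialSeg_law (n : ℕ) :
    p.law.map (initialSeg n) = (Measure.pi fun _ => μ).withDensity (p.joint n) := by
  refine Measure.ext_of_lintegral _ fun f hf => ?_
  rw [lintegral_map hf (measurable_initialSeg n), lintegral_law_initialSeg p n hf,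
    lintegral_withDensity_eq_lintegral_mul _ (p.measurable_joint n) hf]
  rfl

/-! ### The distribution as a kernel, and its disintegration over the history -/

variable {T : Type*} [MeasurableSpace T]

/-- The distributions of a jointly measurable family of strategies, as a kernel on the parameter
space. -/
noncomputable def lawKernel (s : T → PredictionStrategy μ)
    (hs : ∀ n, Measurable fun z : T × (Fin n → X) × X => (s z.1).dens n z.2.1 z.2.2) :
    Kernel T (ℕ → X) where
  toFun θ := (s θ).law
  measurable' := by
    refine Measurable.measure_of_isPiSystem_of_isProbabilityMeasure
      generateFrom_initialFiltration isPiSystem_initialFiltration ?_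
    rintro _ ⟨n, A, hA, rfl⟩
    have (θ : T) : (s θ).law (initialSeg n ⁻¹' A) =
        ∫⁻ h in A, (s θ).joint n h ∂Measure.pi fun _ => μ := by
      rw [← Measure.map_apply (measurable_initialSeg n) hA, map_initialSeg_law,
        withDensity_apply _ hA]
    simp only [this]
    exact (measurable_joint_family hs n).lintegral_prod_right'

variable {s : T → PredictionStrategy μ}
  {hs : ∀ n, Measurable fun z : T × (Fin n → X) × X => (s z.1).dens n z.2.1 z.2.2}

theorem lawKernel_apply (θ : T) : lawKernel s hs θ = (s θ).law := rfl

instance : IsMarkovKernel (lawKernel s hs) :=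
  ⟨fun θ => inferInstanceAs (IsProbabilityMeasure (s θ).law)⟩

omit [SigmaFinite μ] in
theorem measurable_cond_family (n m : ℕ) :
    Measurable fun z : (Fin n → X) × (Fin m → X) × X => (p.cond z.1).dens m z.2.1 z.2.2 :=
  (p.measurable_dens (n + m)).comp ((measurable_append_uncurry.comp
    (measurable_fst.prodMk measurable_snd.fst)).prodMk measurable_snd.snd)

/-- The kernel that sends a history to the distribution of the remaining outcomes. -/
noncomputable def condKernel (n : ℕ) : Kernel (Fin n → X) (ℕ → X) :=
  lawKernel p.cond (p.measurable_cond_family n)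

theorem condKernel_apply {n : ℕ} (h : Fin n → X) : p.condKernel n h = (p.cond h).law := rfl

instance (n : ℕ) : IsMarkovKernel (p.condKernel n) := by
  unfold condKernel; infer_instance

end PredictionStrategy

/-- The sequence that starts with `h` and goes on with `y`. -/
def glue {X : Type*} {n : ℕ} (z : (Fin n → X) × (ℕ → X)) : ℕ → X :=
  fun i => if hi : i < n then z.1 ⟨i, hi⟩ else z.2 (i - n)

theorem initialSeg_glue {X : Type*} {n : ℕ} (m : ℕ) (z : (Fin n → X) × (ℕ → X)) :
    initialSeg (n + m) (glue z) = Fin.append z.1 (initialSeg m z.2) := by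
  ext i
  refine Fin.addCases (fun i => ?_) (fun i => ?_) i
  · simp [initialSeg, glue]
  · simp [initialSeg, glue]

theorem initialSeg_shift_glue {X : Type*} {n : ℕ} (z : (Fin n → X) × (ℕ → X)) :
    (initialSeg n (glue z), fun i => glue z (n + i)) = z := by
  refine Prod.ext ?_ ?_
  · ext i; simp [initialSeg, glue]
  · ext i; simp [glue]

theorem measurable_glue {X : Type*} [MeasurableSpace X] {n : ℕ} :
    Measurable (glue : (Fin n → X) × (ℕ → X) → ℕ → X) := by
  refine measurable_pi_lambda _ fun i => ?_
  unfold glue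
  by_cases hi : i < n
  · simpa [hi] using measurable_fst.eval
  · simpa [hi] using measurable_snd.eval

theorem mutuallySingular_of_map {α β : Type*} [MeasurableSpace α] [MeasurableSpace β]
    {P Q : Measure α} {f : α → β} (hf : Measurable f) (h : P.map f ⟂ₘ Q.map f) : P ⟂ₘ Q := by
  obtain ⟨S, hS, h1, h2⟩ := h
  rw [Measure.map_apply hf hS] at h1
  rw [Measure.map_apply hf hS.compl] at h2
  exact ⟨_, hf hS, h1, h2⟩

namespace PredictionStrategy

variable {X : Type*} [MeasurableSpace X] {μ : Measure X} [SigmaFinite μ]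

theorem lintegral_joint_append (p : PredictionStrategy μ) (n m : ℕ)
    {f : (Fin (n + m) → X) → ℝ≥0∞} (hf : Measurable f) :
    ∫⁻ y, p.joint (n + m) y * f y ∂Measure.pi (fun _ => μ) =
      ∫⁻ x, ∫⁻ y, f (Fin.append (initialSeg n x) (initialSeg m y))
        ∂p.condKernel n (initialSeg n x) ∂p.law := by
  have hj : Measurable fun z : (Fin n → X) × (Fin m → X) =>
      (p.cond z.1).joint m z.2 * f (Fin.append z.1 z.2) :=
    (measurable_joint_family (p.measurable_cond_family n) m).mul (hf.comp measurable_append_uncurry)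
  have inner (h : Fin n → X) : ∫⁻ y, f (Fin.append h (initialSeg m y)) ∂p.condKernel n h =
      ∫⁻ y, (p.cond h).joint m y * f (Fin.append h y) ∂Measure.pi fun _ => μ := by
    rw [condKernel_apply]
    exact lintegral_law_initialSeg _ m (f := fun y => f (Fin.append h y))
      (hf.comp (measurable_append h))
  simp only [inner]
  have hF : Measurable fun h : Fin n → X =>
      ∫⁻ y, (p.cond h).joint m y * f (Fin.append h y) ∂Measure.pi fun _ => μ :=
    hj.lintegral_prod_right'
  have hG : Measurable fun h : Fin (n + m) → X => p.joint (n + m) h * f h :=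
    (p.measurable_joint _).mul hf
  rw [lintegral_law_initialSeg p n hF, lintegral_pi_add μ hG]
  refine lintegral_congr fun h => ?_
  have hy : Measurable fun y => (p.cond h).joint m y * f (Fin.append h y) :=
    ((p.cond h).measurable_joint m).mul (hf.comp (measurable_append h))
  rw [← lintegral_const_mul _ hy]
  simp only [joint_append, mul_assoc]

/-- The law of `p` is obtained by drawing the first `n` outcomes and then the rest from the
strategy that `p` induces after them. -/
theorem law_eq_map_glue (p : PredictionStrategy μ) (n : ℕ) :
    p.law = (p.law.map (initialSeg n) ⊗ₘ p.condKernel n).map glue := by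
  have : IsProbabilityMeasure (p.law.map (initialSeg n)) :=
    Measure.isProbabilityMeasure_map (measurable_initialSeg n).aemeasurable
  refine Measure.ext_of_map_initialSeg n fun m => Measure.ext_of_lintegral _ fun f hf => ?_
  have hg : Measurable fun z : (Fin n → X) × (ℕ → X) => f (Fin.append z.1 (initialSeg m z.2)) :=
    hf.comp (measurable_append_uncurry.comp
      (measurable_fst.prodMk ((measurable_initialSeg m).comp measurable_snd)))
  have hg' : Measurable fun h => ∫⁻ y, f (Fin.append h (initialSeg m y)) ∂p.condKernel n h :=
    hg.lintegral_kernel_prod_right'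
  rw [lintegral_map hf (measurable_initialSeg _), lintegral_map hf (measurable_initialSeg _),
    lintegral_map (f := fun x => f (initialSeg (n + m) x)) (hf.comp (measurable_initialSeg _))
      measurable_glue,
    lintegral_law_initialSeg p _ hf]
  simp only [initialSeg_glue]
  rw [Measure.lintegral_compProd hg, lintegral_map hg' (measurable_initialSeg n),
    lintegral_joint_append p n m hf]

theorem map_split_law (p : PredictionStrategy μ) (n : ℕ) :
    p.law.map (fun x => (initialSeg n x, fun i => x (n + i))) =
      p.law.map (initialSeg n) ⊗ₘ p.condKernel n := by
  have hm : Measurable fun x : ℕ → X => (initialSeg n x, fun i => x (n + i)) :=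
    (measurable_initialSeg n).prodMk (measurable_pi_lambda _ fun _ => measurable_pi_apply _)
  conv_lhs => rw [p.law_eq_map_glue n, Measure.map_map hm measurable_glue]
  have : (fun x : ℕ → X => (initialSeg n x, fun i => x (n + i))) ∘ glue = id :=
    funext initialSeg_shift_glue
  rw [this, Measure.map_id]

/-- Mutual singularity of two strategies after every history of some fixed length implies mutual
singularity from the outset. -/
theorem mutuallySingular_law_of_cond [MeasurableSpace.CountablyGenerated X]
    {p q : PredictionStrategy μ} (n : ℕ)
    (h : ∀ x : Fin n → X, (p.cond x).law ⟂ₘ (q.cond x).law) : p.law ⟂ₘ q.law := by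
  have hm : Measurable fun x : ℕ → X => (initialSeg n x, fun i => x (n + i)) :=
    (measurable_initialSeg n).prodMk (measurable_pi_lambda _ fun _ => measurable_pi_apply _)
  have := countablyGenerated_sequence (X := X)
  have h' (x : Fin n → X) : p.condKernel n x ⟂ₘ q.condKernel n x := by
    rw [condKernel_apply, condKernel_apply]
    exact h x
  have hs : p.law.map (fun x => (initialSeg n x, fun i => x (n + i))) ⟂ₘ
      q.law.map (fun x => (initialSeg n x, fun i => x (n + i))) := by
    rw [map_split_law, map_split_law]
    exact Measure.MutuallySingular.compProd_of_right _ _ (.of_forall h')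
  exact mutuallySingular_of_map hm hs

end PredictionStrategy

/-! ### Bayesian strategies as mixtures -/

namespace ParametricModel

variable {X : Type*} [MeasurableSpace X] {μ : Measure X} [SigmaFinite μ] (M : ParametricModel μ)
  (w : Measure M.Θ) [IsProbabilityMeasure w]

open PredictionStrategy

theorem lintegral_marginal_mul (n : ℕ) {f : (Fin n → X) → ℝ≥0∞} (hf : Measurable f) :
    ∫⁻ h, M.marginal w n h * f h ∂Measure.pi (fun _ => μ) =
      ∫⁻ x, f (initialSeg n x) ∂w.bind (lawKernel M.strat M.measurable_strat) := by
  have hj := measurable_joint_family M.measurable_strat n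
  rw [Measure.lintegral_bind (f := fun x => f (initialSeg n x)) (Kernel.measurable _).aemeasurable
    (hf.comp (measurable_initialSeg n)).aemeasurable]
  simp only [lawKernel_apply]
  simp_rw [fun θ => (M.strat θ).lintegral_law_initialSeg n hf]
  rw [lintegral_lintegral_swap (hj.mul (hf.comp measurable_snd)).aemeasurable]
  refine lintegral_congr fun h => ?_
  rw [marginal, lintegral_mul_const]
  exact hj.comp (measurable_id.prodMk measurable_const)

omit [SigmaFinite μ] in
theorem measurable_marginal (n : ℕ) : Measurable (M.marginal w n) :=
  (measurable_joint_family M.measurable_strat n).lintegral_prod_left'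

theorem marginal_ne_top (n : ℕ) :
    ∀ᵐ h ∂Measure.pi (fun _ : Fin n => μ), M.marginal w n h ≠ ∞ := by
  refine (ae_lt_top (M.measurable_marginal w n) ?_).mono fun _ h => h.ne
  have := M.lintegral_marginal_mul w n (f := fun _ => 1) measurable_const
  simp only [mul_one, lintegral_const] at this
  rw [this, measure_univ]
  simp

variable {M w}

/-- The exceptional histories, on which the Bayesian prediction is unconstrained, do not matter:
those of marginal density `0` stay so when they are prolonged, and those of marginal density `∞`
are null. -/
theorem IsBayes.joint_ae_eq {p : PredictionStrategy μ} (hp : M.IsBayes w p) (n : ℕ) :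
    p.joint n =ᵐ[Measure.pi fun _ => μ] M.marginal w n := by
  induction n with
  | zero => exact .of_forall fun x => by simp [joint_zero, marginal]
  | succ n ih =>
    have hmeas : MeasurableSet {h | p.joint (n + 1) h = M.marginal w (n + 1) h} :=
      measurableSet_eq_fun (p.measurable_joint _) (M.measurable_marginal w _)
    have hz : ∫⁻ h, Set.indicator {h | p.joint (n + 1) h = M.marginal w (n + 1) h}ᶜ 1 h
        ∂Measure.pi (fun _ => μ) = 0 := by
      rw [lintegral_pi_succ μ (measurable_one.indicator hmeas.compl), lintegral_eq_zero_iff']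
      · filter_upwards [ih, M.marginal_ne_top w n] with h hh htop
        simp only [Pi.zero_apply]
        suffices ∀ x, p.joint (n + 1) (Fin.snoc h x) = M.marginal w (n + 1) (Fin.snoc h x) by
          simp [this]
        intro x
        rw [joint_snoc, hh]
        by_cases h0 : M.marginal w n h = 0
        · have hj := measurable_joint_family M.measurable_strat n
          rw [h0, zero_mul, eq_comm, marginal, lintegral_eq_zero_iff' ?_]
          · rw [marginal, lintegral_eq_zero_iff' ?_] at h0
            · filter_upwards [h0] with θ hθ
              rw [joint_snoc, hθ]
              simp
            · exact (hj.comp (measurable_id.prodMk measurable_const)).aemeasurable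
          · exact ((measurable_joint_family M.measurable_strat (n + 1)).comp
              (measurable_prodMk_right (y := Fin.snoc h x))).aemeasurable
        · rw [hp n h h0 htop, ENNReal.mul_div_cancel h0 htop]
      · exact ((measurable_one.indicator hmeas.compl).comp
          measurable_snoc).lintegral_prod_right'.aemeasurable
    rw [lintegral_indicator_one hmeas.compl] at hz
    exact hz

/-- A Bayesian strategy is the mixture of the elements of the model according to the prior. -/
theorem IsBayes.law_eq_bind {p : PredictionStrategy μ} (hp : M.IsBayes w p) :
    p.law = w.bind (lawKernel M.strat M.measurable_strat) := by
  refine Measure.ext_of_map_initialSeg 0 fun n => Measure.ext_of_lintegral _ fun f hf => ?_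
  rw [lintegral_map hf (measurable_initialSeg _), lintegral_map hf (measurable_initialSeg _),
    p.lintegral_law_initialSeg _ hf, ← M.lintegral_marginal_mul w _ hf]
  exact lintegral_congr_ae ((hp.joint_ae_eq _).mul (ae_eq_refl f))

end ParametricModel

/-! ### Density ratios of mutually singular measures -/

section Levy

variable {X : Type*} [MeasurableSpace X]

/-- If `P` and `Q` are mutually singular and their restrictions to the first `n` outcomes have
densities `f n` and `g n`, then `f n / (f n + g n) → 1` almost surely under `P`: this ratio is the
conditional expectation, under `P + Q`, of the indicator of a set that carries `P` and is `Q`-null,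
so that Lévy's upward theorem applies. -/
theorem tendsto_density_div_add {P Q : Measure (ℕ → X)} [IsFiniteMeasure P] [IsFiniteMeasure Q]
    (hPQ : P ⟂ₘ Q) {ρ : (n : ℕ) → Measure (Fin n → X)} {f g : (n : ℕ) → (Fin n → X) → ℝ≥0∞}
    (hf : ∀ n, Measurable (f n)) (hg : ∀ n, Measurable (g n))
    (hP : ∀ n, P.map (initialSeg n) = (ρ n).withDensity (f n))
    (hQ : ∀ n, Q.map (initialSeg n) = (ρ n).withDensity (g n)) :
    ∀ᵐ x ∂P, Tendsto (fun n => f n (initialSeg n x) / (f n (initialSeg n x) + g n (initialSeg n x)))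
      atTop (𝓝 1) := by
  obtain ⟨S, hS, hPS, hQS⟩ := hPQ
  let r (n : ℕ) (x : ℕ → X) : ℝ≥0∞ :=
    f n (initialSeg n x) / (f n (initialSeg n x) + g n (initialSeg n x))
  have hr_le (n x) : r n x ≤ 1 := ENNReal.div_le_of_le_mul (by rw [one_mul]; exact le_self_add)
  have hr_top (n x) : r n x ≠ ∞ := ((hr_le n x).trans_lt ENNReal.one_lt_top).ne
  have hr_meas' (n : ℕ) : Measurable fun h => f n h / (f n h + g n h) :=
    (hf n).div ((hf n).add (hg n))
  have hr_meas_n (n : ℕ) : Measurable[initialFiltration n] (r n) :=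
    (hr_meas' n).comp (comap_measurable (initialSeg n))
  have hr_meas (n : ℕ) : Measurable (r n) := (hr_meas_n n).mono (initialFiltration.le n) le_rfl
  have hfin (n : ℕ) : ∀ᵐ h ∂ρ n, f n h ≠ ∞ := by
    refine (ae_lt_top (hf n) ?_).mono fun _ h => h.ne
    rw [← setLIntegral_univ, ← withDensity_apply _ MeasurableSet.univ, ← hP]
    have := Measure.isFiniteMeasure_map P (initialSeg (X := X) n)
    exact measure_ne_top _ _
  have hfin' (n : ℕ) : ∀ᵐ h ∂ρ n, g n h ≠ ∞ := by
    refine (ae_lt_top (hg n) ?_).mono fun _ h => h.ne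
    rw [← setLIntegral_univ, ← withDensity_apply _ MeasurableSet.univ, ← hQ]
    have := Measure.isFiniteMeasure_map Q (initialSeg (X := X) n)
    exact measure_ne_top _ _
  -- integrating the ratio against `P + Q` gives back `P`
  have hint (n : ℕ) (A : Set (Fin n → X)) (hA : MeasurableSet A) :
      ∫⁻ x in initialSeg n ⁻¹' A, r n x ∂(P + Q) = P (initialSeg n ⁻¹' A) := by
    have hsplit (ν : Measure (ℕ → X)) (k : (Fin n → X) → ℝ≥0∞) (hk : Measurable k)
        (hν : ν.map (initialSeg n) = (ρ n).withDensity k) :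
        ∫⁻ x in initialSeg n ⁻¹' A, r n x ∂ν =
          ∫⁻ h in A, k h * (f n h / (f n h + g n h)) ∂ρ n := by
      rw [← setLIntegral_map hA (hr_meas' n) (measurable_initialSeg n), hν,
        setLIntegral_withDensity_eq_setLIntegral_mul _ hk (hr_meas' n) hA]
      rfl
    have hfr : Measurable fun h => f n h * (f n h / (f n h + g n h)) := (hf n).mul (hr_meas' n)
    rw [Measure.restrict_add, lintegral_add_measure, hsplit P _ (hf n) (hP n),
      hsplit Q _ (hg n) (hQ n), ← lintegral_add_left hfr,
      ← Measure.map_apply (measurable_initialSeg n) hA, hP, withDensity_apply _ hA]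
    refine lintegral_congr_ae (ae_restrict_of_ae ?_)
    filter_upwards [hfin n, hfin' n] with h h1 h2
    rw [← add_mul]
    by_cases h0 : f n h + g n h = 0
    · rw [h0, zero_mul, (add_eq_zero.1 h0).1]
    · exact ENNReal.mul_div_cancel h0 (ENNReal.add_ne_top.2 ⟨h1, h2⟩)
  have hcond (n : ℕ) : (fun x => (r n x).toReal) =ᵐ[P + Q]
      (P + Q)[Sᶜ.indicator fun _ => (1 : ℝ) | initialFiltration n] := by
    have hi : Integrable (fun x => (r n x).toReal) (P + Q) := by
      refine Integrable.of_bound (hr_meas n).ennreal_toReal.aestronglyMeasurable 1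
        (.of_forall fun x => ?_)
      rw [Real.norm_of_nonneg ENNReal.toReal_nonneg]
      exact ENNReal.toReal_le_of_le_ofReal zero_le_one (by simpa using hr_le n x)
    refine ae_eq_condExp_of_forall_setIntegral_eq (initialFiltration.le n)
      ((integrable_const 1).indicator hS.compl) (fun s _ _ => hi.integrableOn) ?_
      (hr_meas_n n).ennreal_toReal.stronglyMeasurable.aestronglyMeasurable
    rintro _ ⟨A, hA, rfl⟩ -
    have hA' := measurable_initialSeg n hA
    rw [integral_toReal (hr_meas n).aemeasurable (.of_forall fun x => (hr_top n x).lt_top),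
      hint n A hA, setIntegral_indicator hS.compl, setIntegral_const, smul_eq_mul, mul_one,
      measureReal_def]
    congr 1
    rw [Measure.add_apply, measure_mono_null Set.inter_subset_right hQS, add_zero,
      measure_inter_conull]
    rwa [compl_compl]
  have hlim := tendsto_ae_condExp (μ := P + Q) (ℱ := initialFiltration)
    (Sᶜ.indicator fun _ => (1 : ℝ))
  rw [iSup_initialFiltration, condExp_of_stronglyMeasurable le_rfl
    (stronglyMeasurable_const.indicator hS.compl) ((integrable_const 1).indicator hS.compl)] at hlim
  have hac : P ≪ P + Q := Measure.absolutelyContinuous_of_le (Measure.le_add_right le_rfl)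
  have hPS' : ∀ᵐ x ∂P, x ∈ Sᶜ := by simpa [ae_iff] using hPS
  filter_upwards [hac.ae_le hlim, hac.ae_le (ae_all_iff.2 hcond), hPS'] with x h1 h2 h3
  simp only [← h2, Set.indicator_of_mem h3] at h1
  have h4 := ENNReal.tendsto_ofReal h1
  simpa only [ENNReal.ofReal_toReal (hr_top _ x), ENNReal.ofReal_one] using h4

end Levy

/-! ### Truncation of switching parameters -/

namespace SwitchParam

theorem segs_injective : Function.Injective segs := by
  rintro ⟨⟩ ⟨⟩ h
  cases h
  rfl

instance : Countable SwitchParam := segs_injective.countable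

/-- The switching parameter that never switches. -/
def single (k : ℕ+) : SwitchParam where
  segs := [(0, k)]
  ne_nil := by simp
  start := rfl
  increasing := by simp

theorem K_single (k : ℕ+) (n : ℕ) : (single k).K n = k := by
  simp [K, single]

/-- The index of the strategy that `s` uses after its last switch. -/
def last (s : SwitchParam) : ℕ+ := (s.segs.getLast s.ne_nil).2

theorem filter_prefix {l : List (ℕ × ℕ+)} (hl : l.Pairwise fun a b => a.1 < b.1) (n : ℕ) :
    l.filter (fun a => decide (a.1 ≤ n)) <+: l := by
  induction l with
  | nil => simp
  | cons a l ih =>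
    rw [List.pairwise_cons] at hl
    by_cases ha : a.1 ≤ n
    · rw [List.filter_cons_of_pos (by simpa using ha), List.cons_prefix_cons]
      exact ⟨rfl, ih hl.2⟩
    · have : (a :: l).filter (fun a => decide (a.1 ≤ n)) = [] := by
        rw [List.filter_eq_nil_iff]
        intro b hb
        rcases List.mem_cons.1 hb with rfl | hb
        · simpa using ha
        · have := hl.1 b hb
          simp only [decide_eq_true_eq]
          lia
      rw [this]
      exact List.nil_prefix

/-- The switching parameter that remains of `s` when the switches after time `n` are dropped. -/
def trunc (n : ℕ) (s : SwitchParam) : SwitchParam where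
  segs := s.segs.filter fun a => decide (a.1 ≤ n)
  ne_nil := s.filter_ne_nil n
  start := by rw [(filter_prefix s.increasing n).head (s.filter_ne_nil n)]; exact s.start
  increasing := s.increasing.filter _

theorem last_trunc (n : ℕ) (s : SwitchParam) : (s.trunc n).last = s.K n := rfl

theorem K_trunc {n i : ℕ} (hi : i ≤ n) (s : SwitchParam) : (s.trunc n).K i = s.K i := by
  have : (s.segs.filter fun a => decide (a.1 ≤ n)).filter (fun a => decide (a.1 ≤ i)) =
      s.segs.filter fun a => decide (a.1 ≤ i) := by
    rw [List.filter_filter]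
    refine List.filter_congr fun a _ => ?_
    by_cases h : a.1 ≤ i
    · simp [h, h.trans hi]
    · simp [h]
  simp only [K, trunc, this]

theorem eq_or_mem_ext_trunc (n : ℕ) (s : SwitchParam) : s = s.trunc n ∨ s ∈ (s.trunc n).ext := by
  have hpre : (s.trunc n).segs <+: s.segs := filter_prefix s.increasing n
  rcases hpre.length_le.eq_or_lt with h | h
  · exact Or.inl (segs_injective (hpre.eq_of_length h).symm)
  · exact Or.inr ⟨h, hpre⟩

/-- After its last switch-point, `s` uses the strategy with index `s.last`. -/
theorem exists_K_eq_last (s : SwitchParam) : ∃ N, ∀ n, N ≤ n → s.K n = s.last := by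
  refine ⟨s.segs.toFinset.sup Prod.fst, fun n hn => ?_⟩
  have : s.segs.filter (fun a => decide (a.1 ≤ n)) = s.segs := by
    rw [List.filter_eq_self]
    intro a ha
    simpa using (Finset.le_sup (f := Prod.fst) (List.mem_toFinset.2 ha)).trans hn
  simp only [K, last, this]

theorem tsum_trunc_fiber_le {π : PMF SwitchParam} {c : ℝ≥0}
    (hc : ∀ s : SwitchParam, ∑' s' : s.ext, π s'.1 ≤ c * π s) (n : ℕ) (t : SwitchParam) :
    ∑' s : {s : SwitchParam // s.trunc n = t}, π s.1 ≤ (1 + c) * π t := by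
  have hsub : {s : SwitchParam | s.trunc n = t} ⊆ {t} ∪ t.ext := by
    rintro s rfl
    exact s.eq_or_mem_ext_trunc n
  calc ∑' s : {s : SwitchParam | s.trunc n = t}, π s.1
      ≤ ∑' s : ({t} ∪ t.ext : Set SwitchParam), π s.1 := ENNReal.tsum_mono_subtype π hsub
    _ ≤ ∑' s : ({t} : Set SwitchParam), π s.1 + ∑' s : t.ext, π s.1 :=
        ENNReal.tsum_union_le π _ _
    _ ≤ (1 + c) * π t := by
        rw [tsum_singleton t π, add_mul, one_mul]
        gcongr
        exact hc t

end SwitchParam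

/-! ### The switch distribution -/

section Switch

variable {X : Type*} [MeasurableSpace X] {μ : Measure X}

open SwitchParam PredictionStrategy

theorem joint_switchStrategy_single (p : ℕ+ → PredictionStrategy μ) (k : ℕ+) (n : ℕ)
    (x : Fin n → X) : (switchStrategy p (single k)).joint n x = (p k).joint n x := by
  simp only [joint, switchStrategy, K_single]

theorem joint_switchStrategy_trunc (p : ℕ+ → PredictionStrategy μ) (s : SwitchParam) (n : ℕ)
    (x : Fin n → X) : (switchStrategy p (s.trunc n)).joint n x = (switchStrategy p s).joint n x := by
  refine Finset.prod_congr rfl fun i _ => ?_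
  simp only [switchStrategy, K_trunc i.isLt.le]

/-- The posterior weight of the wrong models at time `n` is bounded by that of the parameters that
end with a wrong model: to predict the first `n` outcomes, `s` and its truncation at `n` are
equivalent, and the prior weight of all `s` with the same truncation is at most `1 + c` times that
of the truncation. -/
theorem tsum_K_ne_le (p : ℕ+ → PredictionStrategy μ) {π : PMF SwitchParam} {c : ℝ≥0}
    (hc : ∀ s : SwitchParam, ∑' s' : s.ext, π s'.1 ≤ c * π s) (n : ℕ) (x : Fin n → X) (k : ℕ+) :
    ∑' s : {s : SwitchParam // s.K n ≠ k}, (switchStrategy p s.1).joint n x * π s.1 ≤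
      ∑' s : {s : SwitchParam // s.last ≠ k},
        (switchStrategy p s.1).joint n x * ((1 + c) * π s.1) := by
  classical
  let J (t : SwitchParam) : ℝ≥0∞ := if t.last ≠ k then (switchStrategy p t).joint n x else 0
  have hL : ∑' s : {s : SwitchParam // s.K n ≠ k}, (switchStrategy p s.1).joint n x * π s.1 =
      ∑' s : SwitchParam, J (s.trunc n) * π s := by
    refine (tsum_subtype {s : SwitchParam | s.K n ≠ k}
      fun s => (switchStrategy p s).joint n x * π s).trans ?_
    refine tsum_congr fun s => ?_
    simp only [J, last_trunc, joint_switchStrategy_trunc, Set.indicator_apply, Set.mem_ofPred_eq]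
    split_ifs <;> simp
  have hR : ∑' s : {s : SwitchParam // s.last ≠ k},
      (switchStrategy p s.1).joint n x * ((1 + c) * π s.1) =
      ∑' t : SwitchParam, J t * ((1 + c) * π t) := by
    refine (tsum_subtype {s : SwitchParam | s.last ≠ k}
      fun s => (switchStrategy p s).joint n x * ((1 + c) * π s)).trans ?_
    refine tsum_congr fun s => ?_
    simp only [J, Set.indicator_apply, Set.mem_ofPred_eq]
    split_ifs <;> simp
  rw [hL, hR, ← (Equiv.sigmaFiberEquiv (trunc n)).tsum_eq, ENNReal.tsum_sigma']
  refine ENNReal.tsum_le_tsum fun t => ?_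
  have : ∀ s : {s : SwitchParam // s.trunc n = t},
      J ((Equiv.sigmaFiberEquiv (trunc n) ⟨t, s⟩).trunc n) *
        π (Equiv.sigmaFiberEquiv (trunc n) ⟨t, s⟩) = J t * π s.1 := by
    rintro ⟨s, rfl⟩
    rfl
  rw [tsum_congr this, ENNReal.tsum_mul_left]
  gcongr
  exact tsum_trunc_fiber_le hc n t

variable [SigmaFinite μ]

theorem mutuallySingular_switchStrategy [MeasurableSpace.CountablyGenerated X]
    {p : ℕ+ → PredictionStrategy μ}
    (hsing : ∀ k k' : ℕ+, k ≠ k' → ∀ (n : ℕ) (h : Fin n → X),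
      ((p k).cond h).law ⟂ₘ ((p k').cond h).law) {k : ℕ+} {s : SwitchParam} (hs : s.last ≠ k) :
    (p k).law ⟂ₘ (switchStrategy p s).law := by
  obtain ⟨N, hN⟩ := s.exists_K_eq_last
  refine mutuallySingular_law_of_cond N fun h => ?_
  have : (switchStrategy p s).cond h = (p s.last).cond h := by
    simp only [PredictionStrategy.cond, switchStrategy, hN _ (Nat.le_add_right N _)]
  rw [this]
  exact hsing _ _ hs.symm N h

theorem map_initialSeg_sum_law {ι : Type*} [Countable ι] (q : ι → PredictionStrategy μ)
    (v : ι → ℝ≥0∞) (n : ℕ) :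
    (Measure.sum fun i => v i • (q i).law).map (initialSeg n) =
      (Measure.pi fun _ => μ).withDensity fun h => ∑' i, (q i).joint n h * v i := by
  have : (fun h : Fin n → X => ∑' i, (q i).joint n h * v i) = ∑' i, v i • (q i).joint n := by
    ext h
    rw [ENNReal.tsum_apply]
    simp [mul_comm]
  rw [Measure.map_sum (measurable_initialSeg n).aemeasurable, this,
    withDensity_tsum fun i => ((q i).measurable_joint n).const_smul (v i)]
  congr 1
  ext1 i
  rw [Measure.map_smul, map_initialSeg_law, withDensity_smul _ ((q i).measurable_joint n)]

omit [SigmaFinite μ] in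
theorem measurable_tsum_joint {ι : Type*} [Countable ι] (q : ι → PredictionStrategy μ)
    (v : ι → ℝ≥0∞) (n : ℕ) : Measurable fun h => ∑' i, (q i).joint n h * v i :=
  Measurable.tsum fun i => ((q i).measurable_joint n).mul_const (v i)

theorem sum_law_univ {ι : Type*} (q : ι → PredictionStrategy μ) (v : ι → ℝ≥0∞) :
    (Measure.sum fun i => v i • (q i).law) Set.univ = ∑' i, v i := by
  simp [Measure.sum_apply _ MeasurableSet.univ]

theorem ae_switchMarginal_ne_top (π : PMF SwitchParam) (p : ℕ+ → PredictionStrategy μ)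
    (q : PredictionStrategy μ) (n : ℕ) :
    ∀ᵐ x ∂q.law, switchMarginal π p n (initialSeg n x) ≠ ∞ := by
  have h : ∀ᵐ h ∂Measure.pi (fun _ : Fin n => μ), switchMarginal π p n h ≠ ∞ := by
    refine (ae_lt_top (measurable_tsum_joint (switchStrategy p) π n) ?_).mono fun _ h => h.ne
    rw [← setLIntegral_univ, ← withDensity_apply _ MeasurableSet.univ,
      ← map_initialSeg_sum_law (switchStrategy p), Measure.map_apply (measurable_initialSeg n)
        MeasurableSet.univ, Set.preimage_univ, sum_law_univ, π.tsum_coe]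
    exact ENNReal.one_ne_top
  have hac : q.law.map (initialSeg n) ≪ Measure.pi fun _ : Fin n => μ := by
    rw [map_initialSeg_law]
    exact withDensity_absolutelyContinuous _ _
  exact ae_of_ae_map (measurable_initialSeg n).aemeasurable (hac.ae_le h)

omit [SigmaFinite μ] in
theorem switchPosterior_le_one (π : PMF SwitchParam) (p : ℕ+ → PredictionStrategy μ) (n : ℕ)
    (x : Fin n → X) (k : ℕ+) : switchPosterior π p n x k ≤ 1 := by
  refine ENNReal.div_le_of_le_mul ?_
  rw [one_mul]
  exact ENNReal.tsum_comp_le_tsum_of_injective Subtype.val_injective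
    fun s => (switchStrategy p s).joint n x * π s

omit [SigmaFinite μ] in
/-- Where the switch marginal is finite, the posterior probability of `k` is at least the density
ratio of a measure proportional to the law of `p k` against a mixture, not depending on `n`, of
strategies that settle on another model. -/
theorem div_add_le_switchPosterior (p : ℕ+ → PredictionStrategy μ) {π : PMF SwitchParam} {c : ℝ≥0}
    (hc : ∀ s : SwitchParam, ∑' s' : s.ext, π s'.1 ≤ c * π s) (n : ℕ) (x : Fin n → X) (k : ℕ+)
    (htop : switchMarginal π p n x ≠ ∞) :
    π (single k) * (p k).joint n x / (π (single k) * (p k).joint n x +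
        ∑' s : {s : SwitchParam // s.last ≠ k},
          (switchStrategy p s.1).joint n x * ((1 + c) * π s.1)) ≤
      switchPosterior π p n x k := by
  set f := π (single k) * (p k).joint n x
  set g := ∑' s : {s : SwitchParam // s.last ≠ k},
    (switchStrategy p s.1).joint n x * ((1 + c) * π s.1)
  have hsum : (∑' s : {s : SwitchParam // s.K n = k}, (switchStrategy p s.1).joint n x * π s.1) +
      ∑' s : {s : SwitchParam // s.K n ≠ k}, (switchStrategy p s.1).joint n x * π s.1 =
      switchMarginal π p n x :=
    ENNReal.summable.tsum_add_tsum_compl (s := {s : SwitchParam | s.K n = k})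
      (f := fun s => (switchStrategy p s).joint n x * π s) ENNReal.summable
  have hA : f ≤ ∑' s : {s : SwitchParam // s.K n = k},
      (switchStrategy p s.1).joint n x * π s.1 := by
    refine le_trans (le_of_eq ?_) (ENNReal.le_tsum ⟨single k, K_single k n⟩)
    rw [joint_switchStrategy_single, mul_comm]
  have hB := tsum_K_ne_le p hc n x k
  rw [switchPosterior, ← hsum]
  rw [← hsum] at htop
  set A := ∑' s : {s : SwitchParam // s.K n = k}, (switchStrategy p s.1).joint n x * π s.1
  set B := ∑' s : {s : SwitchParam // s.K n ≠ k}, (switchStrategy p s.1).joint n x * π s.1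
  rcases eq_or_ne f 0 with h0 | h0
  · simp [h0]
  have hA0 : A + B ≠ 0 := fun h => h0 (le_antisymm (hA.trans (add_eq_zero.1 h).1.le) zero_le)
  rw [ENNReal.le_div_iff_mul_le (Or.inl hA0) (Or.inl htop), div_eq_mul_inv, mul_right_comm,
    ← div_eq_mul_inv]
  refine ENNReal.div_le_of_le_mul ?_
  rw [mul_add, mul_add, mul_comm f A]
  gcongr

/-- Consistency under the distribution of the Bayesian strategy with index `k`. -/
theorem tendsto_switchPosterior [MeasurableSpace.CountablyGenerated X]
    {p : ℕ+ → PredictionStrategy μ} {π : PMF SwitchParam} {k : ℕ+} (ha : π (single k) ≠ 0) {c : ℝ≥0}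
    (hc : ∀ s : SwitchParam, ∑' s' : s.ext, π s'.1 ≤ c * π s)
    (hsing : ∀ k k' : ℕ+, k ≠ k' → ∀ (n : ℕ) (h : Fin n → X),
      ((p k).cond h).law ⟂ₘ ((p k').cond h).law) :
    ∀ᵐ x ∂(p k).law,
      Tendsto (fun n : ℕ => switchPosterior π p n (initialSeg n x) k) atTop (𝓝 1) := by
  set a := π (single k)
  have hatop : a ≠ ∞ := π.apply_ne_top _
  let q (s : {s : SwitchParam // s.last ≠ k}) : PredictionStrategy μ := switchStrategy p s.1
  let v (s : {s : SwitchParam // s.last ≠ k}) : ℝ≥0∞ := (1 + c) * π s.1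
  let P : Measure (ℕ → X) := a • (p k).law
  let Q : Measure (ℕ → X) := Measure.sum fun s => v s • (q s).law
  have : IsFiniteMeasure P := Measure.smul_finite _ hatop
  have : IsFiniteMeasure Q := by
    refine ⟨?_⟩
    rw [sum_law_univ, ENNReal.tsum_mul_left]
    refine ENNReal.mul_lt_top (by simp) ?_
    refine lt_of_le_of_lt (ENNReal.tsum_comp_le_tsum_of_injective Subtype.val_injective π) ?_
    rw [π.tsum_coe]
    exact ENNReal.one_lt_top
  have hPQ : P ⟂ₘ Q := by
    refine Measure.MutuallySingular.sum_right.2 fun s => ?_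
    exact (((mutuallySingular_switchStrategy hsing s.2).smul a).symm.smul (v s)).symm
  have hlim := tendsto_density_div_add hPQ (ρ := fun n => Measure.pi fun _ => μ)
    (f := fun n h => a * (p k).joint n h) (g := fun n h => ∑' s, (q s).joint n h * v s)
    (fun n => ((p k).measurable_joint n).const_mul a) (fun n => measurable_tsum_joint q v n)
    (fun n => by
      rw [Measure.map_smul, PredictionStrategy.map_initialSeg_law,
        ← withDensity_smul _ ((p k).measurable_joint n)]
      rfl)
    (fun n => map_initialSeg_sum_law q v n)
  rw [Measure.ae_ennreal_smul_measure_iff ha] at hlim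
  filter_upwards [hlim, ae_all_iff.2 fun n => ae_switchMarginal_ne_top π p (p k) n] with x h1 h2
  exact tendsto_of_tendsto_of_tendsto_of_le_of_le h1 tendsto_const_nhds
    (fun n => div_add_le_switchPosterior p hc n _ k (h2 n))
    (fun n => switchPosterior_le_one π p n _ k)

end Switch

theorem theorem1 {d : ℕ} (X : Set (EuclideanSpace ℝ (Fin d))) (μ : Measure X) [SigmaFinite μ]
    (M : ℕ+ → ParametricModel μ) (w : (k : ℕ+) → Measure (M k).Θ)
    [∀ k, IsProbabilityMeasure (w k)]
    (p : ℕ+ → PredictionStrategy μ) (hp : ∀ k, (M k).IsBayes (w k) (p k))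
    (π : PMF SwitchParam) (hπ_pos : ∀ s : SwitchParam, s.m = 1 → 0 < π s)
    (hπ_ext : ∃ c : ℝ≥0, 0 < c ∧ ∀ s : SwitchParam, ∑' s' : s.ext, π s'.1 ≤ c * π s)
    (hsing : ∀ k k' : ℕ+, k ≠ k' → ∀ (n : ℕ) (h : Fin n → X),
      ((p k).cond h).law ⟂ₘ ((p k').cond h).law) :
    ∀ kstar : ℕ+, ∀ᵐ θ ∂(w kstar), ∀ᵐ x ∂((M kstar).strat θ).law,
      Tendsto (fun n : ℕ => switchPosterior π p n (fun i : Fin n => x i) kstar) atTop (𝓝 1) := by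
  intro k
  obtain ⟨c, -, hc⟩ := hπ_ext
  have h := tendsto_switchPosterior (hπ_pos (SwitchParam.single k) rfl).ne' hc hsing
  rw [(hp k).law_eq_bind] at h
  filter_upwards [Measure.ae_ae_of_ae_comp h] with θ hθ
  rw [PredictionStrategy.lawKernel_apply] at hθ
  exact hθ
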